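/- Let $\mathfrak V$ be the Virasoro algebra, i.e. the real Lie algebra with basis $\{L_m : m\in\mathbb Z\}\cup\{C\}$ and relations $$[L_m,L_k]=(m-k)L_{m+k}+\tfrac1{12}\,m(m^2-1)\,\delta_{m,-k}\,C,\qquad [L_m,C]=0\qquad(m,k\in\mathbb Z),$$ and let $\mathfrak W$ be the Witt algebra, i.e. the real Lie algebra with basis $\{L_m : m\in\mathbb Z\}$ and relations $[L_m,L_k]=(m-k)L_{m+k}$. For an open set $U\subseteq\mathbb R^n$, a realization of a real Lie algebra $\mathfrak g$ on $U$ is a Lie algebra homomorphism (not necessarily injective) from $\mathfrak g$ to the Lie algebra of smooth vector fields $\sum_{i=1}^n a_i(x)\,\partial_{x_i}$ on $U$ with the commutator $[Q,P]=QP-PQ$. Let $n\in\{1,2,3\}$ and let $U\subseteq\mathbb R^n$ be open (for instance $U=\mathbb R^n$). Then: (i) There is no realization $\rho$ of $\mathfrak V$ on $U$ with $\rho(C)\neq 0$. (ii) Consequently, the Witt algebra has no nontrivial central extension realized on $U$: if $\pi:E\to\mathfrak W$ is a surjective homomorphism of real Lie algebras whose kernel is contained in the center of $E$, and $E$ has a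 realization on $U$ that is injective on $\ker\pi$, then the extension splits, i.e. there is a Lie algebra homomorphism $\sigma:\mathfrak W\to E$ with $\pi\circ\sigma=\mathrm{id}$. -/

import Mathlib

open scoped ContDiff

noncomputable section

/-! ### The Witt algebra -/

/-- The Witt bracket on the real vector space with basis `e_n`, `n ∈ ℤ`:
`[e_m, e_n] = (m - n) e_{m+n}`, extended bilinearly. -/
def wittBracket : (ℤ →₀ ℝ) →ₗ[ℝ] (ℤ →₀ ℝ) →ₗ[ℝ] (ℤ →₀ ℝ) :=
  Finsupp.linearCombination ℝ fun m : ℤ =>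
    Finsupp.linearCombination ℝ fun n : ℤ =>
      ((m : ℝ) - (n : ℝ)) • Finsupp.single (m + n) (1 : ℝ)

/-- The Virasoro cocycle: `ω(e_m, e_n) = m (m² - 1) / 12` if `m = -n`, and `0` otherwise,
extended bilinearly. -/
def virasoroCocycle : (ℤ →₀ ℝ) →ₗ[ℝ] (ℤ →₀ ℝ) →ₗ[ℝ] ℝ :=
  Finsupp.linearCombination ℝ fun m : ℤ =>
    Finsupp.linearCombination ℝ fun n : ℤ =>
      if m = -n then (1 / 12 : ℝ) * (m : ℝ) * ((m : ℝ) ^ 2 - 1) else 0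

theorem wittBracket_single (m n : ℤ) :
    wittBracket (Finsupp.single m 1) (Finsupp.single n 1) =
      ((m : ℝ) - (n : ℝ)) • Finsupp.single (m + n) (1 : ℝ) := by
  simp [wittBracket]

theorem virasoroCocycle_single (m n : ℤ) :
    virasoroCocycle (Finsupp.single m 1) (Finsupp.single n 1) =
      if m = -n then (1 / 12 : ℝ) * (m : ℝ) * ((m : ℝ) ^ 2 - 1) else 0 := by
  simp [virasoroCocycle]

theorem wittBracket_swap (x y : ℤ →₀ ℝ) : wittBracket x y = -wittBracket y x := by
  induction x using Finsupp.induction_linear with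
  | zero => simp
  | add f g hf hg => simp only [map_add, LinearMap.add_apply, hf, hg]; abel
  | single m a =>
    induction y using Finsupp.induction_linear with
    | zero => simp
    | add f g hf hg => simp only [map_add, LinearMap.add_apply, hf, hg]; abel
    | single n b =>
      rw [← mul_one a, ← mul_one b]
      simp only [← smul_eq_mul (b := (1 : ℝ)), ← Finsupp.smul_single, map_smul,
        LinearMap.smul_apply, wittBracket_single]
      rw [add_comm n m]
      simp only [smul_smul, ← neg_smul]
      congr 1
      ring

theorem virasoroCocycle_swap (x y : ℤ →₀ ℝ) :
    virasoroCocycle x y = -virasoroCocycle y x := by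
  induction x using Finsupp.induction_linear with
  | zero => simp
  | add f g hf hg => simp only [map_add, LinearMap.add_apply, hf, hg]; abel
  | single m a =>
    induction y using Finsupp.induction_linear with
    | zero => simp
    | add f g hf hg => simp only [map_add, LinearMap.add_apply, hf, hg]; abel
    | single n b =>
      rw [← mul_one a, ← mul_one b]
      simp only [← smul_eq_mul (b := (1 : ℝ)), ← Finsupp.smul_single, map_smul,
        LinearMap.smul_apply, virasoroCocycle_single]
      by_cases hmn : m = -n
      · subst hmn
        rw [if_pos rfl, if_pos (neg_neg n).symm]
        simp only [smul_eq_mul]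
        push_cast
        ring
      · rw [if_neg hmn, if_neg (by omega)]
        simp

theorem wittBracket_self (x : ℤ →₀ ℝ) : wittBracket x x = 0 :=
  self_eq_neg.mp (wittBracket_swap x x)

theorem virasoroCocycle_self (x : ℤ →₀ ℝ) : virasoroCocycle x x = 0 :=
  self_eq_neg.mp (virasoroCocycle_swap x x)

theorem wittBracket_jacobi (x y z : ℤ →₀ ℝ) :
    wittBracket x (wittBracket y z) =
      wittBracket (wittBracket x y) z + wittBracket y (wittBracket x z) := by
  induction x using Finsupp.induction_linear with
  | zero => simp
  | add f g hf hg => simp only [map_add, LinearMap.add_apply, hf, hg]; abel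
  | single m a =>
    induction y using Finsupp.induction_linear with
    | zero => simp
    | add f g hf hg => simp only [map_add, LinearMap.add_apply, hf, hg]; abel
    | single n b =>
      induction z using Finsupp.induction_linear with
      | zero => simp
      | add f g hf hg => simp only [map_add, hf, hg]; abel
      | single k c =>
        rw [← mul_one a, ← mul_one b, ← mul_one c]
        simp only [← smul_eq_mul (b := (1 : ℝ)), ← Finsupp.smul_single, map_smul,
          LinearMap.smul_apply, wittBracket_single]
        rw [show m + n + k = m + (n + k) by ring, show n + (m + k) = m + (n + k) by ring]
        simp only [smul_smul, ← add_smul]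
        congr 1
        push_cast
        ring

theorem virasoroCocycle_jacobi (x y z : ℤ →₀ ℝ) :
    virasoroCocycle x (wittBracket y z) =
      virasoroCocycle (wittBracket x y) z + virasoroCocycle y (wittBracket x z) := by
  induction x using Finsupp.induction_linear with
  | zero => simp
  | add f g hf hg => simp only [map_add, LinearMap.add_apply, hf, hg]; abel
  | single m a =>
    induction y using Finsupp.induction_linear with
    | zero => simp
    | add f g hf hg => simp only [map_add, LinearMap.add_apply, hf, hg]; abel
    | single n b =>
      induction z using Finsupp.induction_linear with
      | zero => simp
      | add f g hf hg => simp only [map_add, hf, hg]; abel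
      | single k c =>
        rw [← mul_one a, ← mul_one b, ← mul_one c]
        simp only [← smul_eq_mul (b := (1 : ℝ)), ← Finsupp.smul_single, map_smul,
          LinearMap.smul_apply, wittBracket_single, virasoroCocycle_single]
        by_cases h : m + n + k = 0
        · have h1 : m = -(n + k) := by omega
          have h2 : m + n = -k := by omega
          have h3 : n = -(m + k) := by omega
          rw [if_pos h1, if_pos h2, if_pos h3]
          have hk : (k : ℝ) = -(m : ℝ) - n := by
            have : k = -m - n := by omega
            rw [this]; push_cast; ring
          simp only [smul_eq_mul]
          push_cast
          rw [hk]
          ring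
        · rw [if_neg (by omega), if_neg (by omega), if_neg (by omega)]
          simp

/-- The Witt algebra: the real Lie algebra with basis `L_n`, `n ∈ ℤ`, and
`[L_m, L_n] = (m - n) L_{m+n}`. -/
def Witt : Type := ℤ →₀ ℝ

namespace Witt

instance : AddCommGroup Witt := inferInstanceAs (AddCommGroup (ℤ →₀ ℝ))

instance : Module ℝ Witt := inferInstanceAs (Module ℝ (ℤ →₀ ℝ))

/-- The basis elements `L_n` of the Witt algebra. -/
def L (n : ℤ) : Witt := Finsupp.single n (1 : ℝ)

instance : Bracket Witt Witt := ⟨fun x y => wittBracket x y⟩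

instance : LieRing Witt where
  add_lie x y z := LinearMap.map_add₂ wittBracket x y z
  lie_add x y z := (wittBracket x).map_add y z
  lie_self x := wittBracket_self x
  leibniz_lie x y z := wittBracket_jacobi x y z

instance : LieAlgebra ℝ Witt where
  lie_smul t x y := (wittBracket x).map_smul t y

theorem lie_L_L (m n : ℤ) : ⁅L m, L n⁆ = ((m : ℝ) - (n : ℝ)) • L (m + n) :=
  wittBracket_single m n

end Witt

/-! ### The Virasoro algebra -/

/-- The Virasoro algebra: the real Lie algebra with basis `L_n`, `n ∈ ℤ`, and `C`, with
`[L_m, L_n] = (m - n) L_{m+n} + (1/12) m (m² - 1) δ_{m,-n} C` and `[L_m, C] = 0`.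
A pair `(x, a)` stands for `x + a C`. -/
def Virasoro : Type := (ℤ →₀ ℝ) × ℝ

namespace Virasoro

instance : AddCommGroup Virasoro := inferInstanceAs (AddCommGroup ((ℤ →₀ ℝ) × ℝ))

instance : Module ℝ Virasoro := inferInstanceAs (Module ℝ ((ℤ →₀ ℝ) × ℝ))

/-- The basis elements `L_n` of the Virasoro algebra. -/
def L (n : ℤ) : Virasoro := (Finsupp.single n (1 : ℝ), (0 : ℝ))

/-- The central element of the Virasoro algebra. -/
def C : Virasoro := ((0 : ℤ →₀ ℝ), (1 : ℝ))

instance : Bracket Virasoro Virasoro :=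
  ⟨fun x y => (wittBracket x.1 y.1, virasoroCocycle x.1 y.1)⟩

instance : LieRing Virasoro where
  add_lie x y z := Prod.ext (LinearMap.map_add₂ wittBracket x.1 y.1 z.1)
    (LinearMap.map_add₂ virasoroCocycle x.1 y.1 z.1)
  lie_add x y z := Prod.ext ((wittBracket x.1).map_add y.1 z.1)
    ((virasoroCocycle x.1).map_add y.1 z.1)
  lie_self x := Prod.ext (wittBracket_self x.1) (virasoroCocycle_self x.1)
  leibniz_lie x y z := Prod.ext (wittBracket_jacobi x.1 y.1 z.1)
    (virasoroCocycle_jacobi x.1 y.1 z.1)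

instance : LieAlgebra ℝ Virasoro where
  lie_smul t x y := Prod.ext ((wittBracket x.1).map_smul t y.1)
    ((virasoroCocycle x.1).map_smul t y.1)

theorem lie_L_L (m n : ℤ) :
    ⁅L m, L n⁆ = ((m : ℝ) - (n : ℝ)) • L (m + n) +
      ((1 / 12 : ℝ) * (m : ℝ) * ((m : ℝ) ^ 2 - 1) * (if m = -n then 1 else 0)) • C := by
  refine Prod.ext ?_ ?_
  · change wittBracket (Finsupp.single m 1) (Finsupp.single n 1) =
      ((m : ℝ) - (n : ℝ)) • Finsupp.single (m + n) (1 : ℝ) + _ • (0 : ℤ →₀ ℝ)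
    rw [wittBracket_single, smul_zero, add_zero]
  · change virasoroCocycle (Finsupp.single m 1) (Finsupp.single n 1) =
      ((m : ℝ) - (n : ℝ)) • (0 : ℝ) + _ • (1 : ℝ)
    rw [virasoroCocycle_single, smul_zero, zero_add]
    simp

theorem lie_C (x : Virasoro) : ⁅x, C⁆ = 0 :=
  Prod.ext (wittBracket x.1).map_zero (virasoroCocycle x.1).map_zero

end Virasoro

/-! ### Smooth vector fields on an open subset of Euclidean space -/

/-- The real vector space of smooth vector fields on an open set `U ⊆ ℝⁿ`. A vector field
`∑ V_i ∂_i` on `U` is recorded by its coefficient vector `V`, extended by `0` outside `U`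
so that equality means equality on `U`. -/
def vectorFieldSubmodule {n : ℕ} (U : TopologicalSpace.Opens (EuclideanSpace ℝ (Fin n))) :
    Submodule ℝ (EuclideanSpace ℝ (Fin n) → EuclideanSpace ℝ (Fin n)) where
  carrier := {V | ContDiffOn ℝ ∞ V U ∧ ∀ p, p ∉ U → V p = 0}
  add_mem' hV hW := ⟨hV.1.add hW.1, fun p hp => by simp [hV.2 p hp, hW.2 p hp]⟩
  zero_mem' := ⟨contDiffOn_const, fun _ _ => rfl⟩
  smul_mem' c V hV := ⟨contDiffOn_const.smul hV.1, fun p hp => by simp [hV.2 p hp]⟩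

/-- The Lie algebra of smooth vector fields on an open set `U ⊆ ℝⁿ`. -/
def SmoothVectorField {n : ℕ} (U : TopologicalSpace.Opens (EuclideanSpace ℝ (Fin n))) : Type :=
  vectorFieldSubmodule U

namespace SmoothVectorField

variable {n : ℕ} {U : TopologicalSpace.Opens (EuclideanSpace ℝ (Fin n))}

instance : AddCommGroup (SmoothVectorField U) :=
  inferInstanceAs (AddCommGroup (vectorFieldSubmodule U))

instance : Module ℝ (SmoothVectorField U) :=
  inferInstanceAs (Module ℝ (vectorFieldSubmodule U))

/-- The coefficient vector of a vector field. -/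
def coeff (V : SmoothVectorField U) : EuclideanSpace ℝ (Fin n) → EuclideanSpace ℝ (Fin n) :=
  V.1

theorem contDiffAt (V : SmoothVectorField U) {p : EuclideanSpace ℝ (Fin n)} (hp : p ∈ U) :
    ContDiffAt ℝ ∞ V.coeff p :=
  V.2.1.contDiffAt (U.isOpen.mem_nhds hp)

theorem differentiableAt (V : SmoothVectorField U) {p : EuclideanSpace ℝ (Fin n)}
    (hp : p ∈ U) : DifferentiableAt ℝ V.coeff p :=
  (V.contDiffAt hp).differentiableAt (by simp)

open Classical in
/-- The commutator `[V, W] = VW - WV` of vector fields on `U`, with coefficient vector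
`DW(p) V(p) - DV(p) W(p)` at `p ∈ U`. -/
instance : Bracket (SmoothVectorField U) (SmoothVectorField U) :=
  ⟨fun V W => ⟨fun p => if p ∈ U then VectorField.lieBracket ℝ V.coeff W.coeff p else 0, by
    refine ⟨fun p hp => ?_, fun p hp => if_neg hp⟩
    refine (((V.contDiffAt hp).lieBracket_vectorField (m := ∞) (W.contDiffAt hp)
      (by simp)).congr_of_eventuallyEq ?_).contDiffWithinAt
    filter_upwards [U.isOpen.mem_nhds hp] with q hq
    exact if_pos hq⟩⟩

theorem lie_coeff (V W : SmoothVectorField U) {p : EuclideanSpace ℝ (Fin n)} (hp : p ∈ U) :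
    (⁅V, W⁆ : SmoothVectorField U).coeff p = VectorField.lieBracket ℝ V.coeff W.coeff p :=
  if_pos hp

theorem lie_coeff_eventuallyEq (V W : SmoothVectorField U) {p : EuclideanSpace ℝ (Fin n)}
    (hp : p ∈ U) : (⁅V, W⁆ : SmoothVectorField U).coeff =ᶠ[nhds p]
      VectorField.lieBracket ℝ V.coeff W.coeff := by
  filter_upwards [U.isOpen.mem_nhds hp] with q hq
  exact lie_coeff V W hq

theorem ext_on {V W : SmoothVectorField U} (h : ∀ p ∈ U, V.coeff p = W.coeff p) : V = W := by
  refine Subtype.ext (funext fun p => ?_)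
  by_cases hp : p ∈ U
  · exact h p hp
  · exact (V.2.2 p hp).trans (W.2.2 p hp).symm

theorem add_coeff (V W : SmoothVectorField U) : (V + W).coeff = V.coeff + W.coeff := rfl

theorem smul_coeff (c : ℝ) (V : SmoothVectorField U) : (c • V).coeff = c • V.coeff := rfl

instance : LieRing (SmoothVectorField U) where
  add_lie X Y Z := ext_on fun p hp => by
    rw [lie_coeff _ _ hp, add_coeff, add_coeff, Pi.add_apply, lie_coeff _ _ hp,
      lie_coeff _ _ hp]
    exact VectorField.lieBracket_add_left (X.differentiableAt hp) (Y.differentiableAt hp)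
  lie_add X Y Z := ext_on fun p hp => by
    rw [lie_coeff _ _ hp, add_coeff, add_coeff, Pi.add_apply, lie_coeff _ _ hp,
      lie_coeff _ _ hp]
    exact VectorField.lieBracket_add_right (Y.differentiableAt hp) (Z.differentiableAt hp)
  lie_self X := ext_on fun p hp => by
    rw [lie_coeff _ _ hp, VectorField.lieBracket_self]
    rfl
  leibniz_lie X Y Z := ext_on fun p hp => by
    rw [add_coeff, Pi.add_apply, lie_coeff _ _ hp, lie_coeff _ _ hp, lie_coeff _ _ hp,
      (Filter.EventuallyEq.refl _ X.coeff).lieBracket_vectorField_eq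
        (lie_coeff_eventuallyEq Y Z hp),
      (lie_coeff_eventuallyEq X Y hp).lieBracket_vectorField_eq
        (Filter.EventuallyEq.refl _ Z.coeff),
      (Filter.EventuallyEq.refl _ Y.coeff).lieBracket_vectorField_eq
        (lie_coeff_eventuallyEq X Z hp)]
    exact VectorField.leibniz_identity_lieBracket (n := ∞)
      (by rw [minSmoothness_of_isRCLikeNormedField]; exact WithTop.coe_le_coe.mpr (le_top : (2 : ℕ∞) ≤ ⊤)) (X.contDiffAt hp)
      (Y.contDiffAt hp) (Z.contDiffAt hp)

instance : LieAlgebra ℝ (SmoothVectorField U) where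
  lie_smul t X Y := ext_on fun p hp => by
    rw [lie_coeff _ _ hp, smul_coeff, smul_coeff, Pi.smul_apply, lie_coeff _ _ hp]
    exact VectorField.lieBracket_const_smul_right (Y.differentiableAt hp)

end SmoothVectorField

/-! ### Realizations and central extensions -/

/-- A realization of a real Lie algebra `𝔤` by smooth vector fields on the open set `U ⊆ ℝⁿ`:
a Lie algebra homomorphism from `𝔤` to the vector fields on `U`. It need not be faithful. -/
abbrev Realization (𝔤 : Type*) [LieRing 𝔤] [LieAlgebra ℝ 𝔤] {n : ℕ}
    (U : TopologicalSpace.Opens (EuclideanSpace ℝ (Fin n))) : Type _ :=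
  𝔤 →ₗ⁅ℝ⁆ SmoothVectorField U

/-- `π : E → 𝔤` is a central extension: it is surjective with central kernel. -/
structure IsCentralExtension {E 𝔤 : Type*} [LieRing E] [LieAlgebra ℝ E] [LieRing 𝔤]
    [LieAlgebra ℝ 𝔤] (π : E →ₗ⁅ℝ⁆ 𝔤) : Prop where
  surjective : Function.Surjective π
  central : ∀ z : E, π z = 0 → ∀ x : E, ⁅x, z⁆ = 0

/-- An extension `π : E → 𝔤` splits (is trivial) if `π` has a Lie algebra section. -/
def IsSplitExtension {E 𝔤 : Type*} [LieRing E] [LieAlgebra ℝ E] [LieRing 𝔤]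
    [LieAlgebra ℝ 𝔤] (π : E →ₗ⁅ℝ⁆ 𝔤) : Prop :=
  ∃ σ : 𝔤 →ₗ⁅ℝ⁆ E, ∀ x : 𝔤, π (σ x) = x

end

/-! The argument works in any finite dimension. For a realization on `U` and `p ∈ U`, the elements
whose vector field vanishes at `p` form a subalgebra of codimension at most `n`, so part (i) reduces
to `Virasoro.C_mem_of_finiteDimensional`: every subalgebra `h` of finite codimension contains `C`.
The image of `h` in the Witt algebra contains all multiples of some Laurent polynomial `f ≠ 0`
(`exists_laurentMul_mem`). Take brackets of lifts of `f T^k` and `f T^(s-k)`. In `k`, the Witt part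
is affine and the cocycle cubic, so a third difference leaves only a multiple of `C`, with factor
half a coefficient of `f²`; some choice of `s` makes it nonzero. For part (ii), suitable lifts of
the `L m` satisfy the Virasoro relations with a central element `z` in place of `C`
(`exists_virasoro_lift`). Part (i) and injectivity on the kernel give `z = 0`, so these lifts span a
section. -/

noncomputable section

/-! ### Weighted convolutions of Laurent polynomials -/

/-- The bilinear map on Laurent polynomials with `T^i, T^j ↦ w i j T^{i+j}`. -/
def weightedConv (w : ℤ → ℤ → ℝ) : (ℤ →₀ ℝ) →ₗ[ℝ] (ℤ →₀ ℝ) →ₗ[ℝ] (ℤ →₀ ℝ) :=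
  Finsupp.linearCombination ℝ fun i : ℤ =>
    Finsupp.linearCombination ℝ fun j : ℤ => w i j • Finsupp.single (i + j) (1 : ℝ)

/-- Multiplication of Laurent polynomials, as a bilinear map on their coefficients. -/
def laurentMul : (ℤ →₀ ℝ) →ₗ[ℝ] (ℤ →₀ ℝ) →ₗ[ℝ] (ℤ →₀ ℝ) := weightedConv fun _ _ => 1

theorem laurentMul_single (i j : ℤ) :
    laurentMul (Finsupp.single i 1) (Finsupp.single j 1) = Finsupp.single (i + j) (1 : ℝ) := by
  simp [laurentMul, weightedConv]

/-- Under the degree bounds only the pair `(m, n)` contributes in degree `m + n`, so leading terms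
cannot cancel. -/
theorem weightedConv_apply_top (w : ℤ → ℤ → ℝ) {a b : ℤ →₀ ℝ} {m n : ℤ}
    (ha : ∀ i ∈ a.support, i ≤ m) (hb : ∀ j ∈ b.support, j ≤ n) :
    weightedConv w a b (m + n) = w m n * a m * b n := by
  have key : weightedConv w a b (m + n) =
      ∑ i ∈ a.support, ∑ j ∈ b.support, if i = m ∧ j = n then w m n * a m * b n else 0 := by
    simp only [weightedConv, Finsupp.linearCombination_apply, Finsupp.sum, LinearMap.coe_sum,
      Finset.sum_apply, LinearMap.smul_apply, Finsupp.finsetSum_apply, Finsupp.smul_apply]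
    refine Finset.sum_congr rfl fun i hi => ?_
    rw [Finset.smul_sum]
    refine Finset.sum_congr rfl fun j hj => ?_
    have hi' := ha i hi
    have hj' := hb j hj
    by_cases h : i = m ∧ j = n
    · obtain ⟨rfl, rfl⟩ := h
      simp
      ring
    · rw [if_neg h]
      have : i + j ≠ m + n := by omega
      simp [this]
  rw [key]
  by_cases hm : a m = 0
  · simp [hm]
  by_cases hn : b n = 0
  · simp [hn]
  rw [Finset.sum_eq_single m, Finset.sum_eq_single n]
  · simp
  · intro j _ hj
    simp [hj]
  · intro h
    exact absurd (Finsupp.mem_support_iff.mpr hn) h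
  · intro i _ hi
    simp [hi]
  · intro h
    exact absurd (Finsupp.mem_support_iff.mpr hm) h

theorem Finsupp.exists_top {a : ℤ →₀ ℝ} (ha : a ≠ 0) : ∃ m, a m ≠ 0 ∧ ∀ i ∈ a.support, i ≤ m :=
  have h := Finsupp.support_nonempty_iff.mpr ha
  ⟨a.support.max' h, Finsupp.mem_support_iff.mp (a.support.max'_mem h),
    fun i hi => a.support.le_max' i hi⟩

theorem laurentMul_self_ne_zero {f : ℤ →₀ ℝ} (hf : f ≠ 0) : laurentMul f f ≠ 0 := by
  obtain ⟨m, hm, hle⟩ := Finsupp.exists_top hf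
  intro h
  have := weightedConv_apply_top (fun _ _ => 1) hle hle
  rw [← laurentMul, h] at this
  simp [hm] at this

theorem wittBracket_ne_zero {a b : ℤ →₀ ℝ} (ha : a ≠ 0) (hb : b ≠ 0)
    (hna : ∀ i ∈ a.support, i < 0) (hnb : ∀ j ∈ b.support, 0 ≤ j) : wittBracket a b ≠ 0 := by
  obtain ⟨m, hm, hma⟩ := Finsupp.exists_top ha
  obtain ⟨n, hn, hnb'⟩ := Finsupp.exists_top hb
  have hm0 := hna m (Finsupp.mem_support_iff.mpr hm)
  have hn0 := hnb n (Finsupp.mem_support_iff.mpr hn)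
  intro h
  have : wittBracket a b (m + n) = _ :=
    weightedConv_apply_top (fun i j => (i : ℝ) - j) hma hnb'
  rw [h] at this
  have hne : (m : ℝ) - n ≠ 0 := sub_ne_zero.mpr (by exact_mod_cast (by omega : m ≠ n))
  simp [hm, hn, hne] at this

/-! ### Finite-codimensional subalgebras -/

/-- The terms that differentiate `g` cancel in the difference. This turns closure under brackets
into closure under multiplication by an arbitrary `g`. -/
theorem wittBracket_laurentMul_sub (a b g : ℤ →₀ ℝ) :
    wittBracket a (laurentMul b g) - wittBracket b (laurentMul a g) =
      (2 : ℝ) • laurentMul (wittBracket a b) g := by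
  induction a using Finsupp.induction_linear with
  | zero => simp
  | add f g hf hg =>
    simp only [map_add, LinearMap.add_apply, smul_add, ← hf, ← hg]; abel
  | single i x =>
    induction b using Finsupp.induction_linear with
    | zero => simp
    | add f g hf hg =>
      simp only [map_add, LinearMap.add_apply, smul_add, ← hf, ← hg]; abel
    | single j y =>
      induction g using Finsupp.induction_linear with
      | zero => simp
      | add f g hf hg =>
        simp only [map_add, smul_add, ← hf, ← hg]; abel
      | single k z =>
        rw [← mul_one x, ← mul_one y, ← mul_one z]
        simp only [← smul_eq_mul (b := (1 : ℝ)), ← Finsupp.smul_single, map_smul,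
          LinearMap.smul_apply, wittBracket_single, laurentMul_single]
        rw [show i + j + k = i + (j + k) by ring, show j + (i + k) = i + (j + k) by ring]
        simp only [smul_smul, ← sub_smul]
        congr 1
        push_cast
        ring

theorem LinearMap.exists_ne_zero_mem_ker {V W : Type*} [AddCommGroup V] [Module ℝ V]
    [AddCommGroup W] [Module ℝ W] [FiniteDimensional ℝ W] (hV : ¬ FiniteDimensional ℝ V)
    (Φ : V →ₗ[ℝ] W) : ∃ v, v ≠ 0 ∧ Φ v = 0 := by
  by_contra! h
  refine hV (FiniteDimensional.of_injective Φ ((injective_iff_map_eq_zero Φ).mpr fun v hv => ?_))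
  by_contra hne
  exact h v hne hv

theorem exists_supported_mem_ker {W : Type*} [AddCommGroup W] [Module ℝ W]
    [FiniteDimensional ℝ W] (Φ : (ℤ →₀ ℝ) →ₗ[ℝ] W) (s : Set ℤ) [Infinite s] :
    ∃ a : ℤ →₀ ℝ, a ≠ 0 ∧ (∀ i ∈ a.support, i ∈ s) ∧ Φ a = 0 := by
  have hinf : ¬ FiniteDimensional ℝ (s →₀ ℝ) := fun h =>
    Module.Finite.not_linearIndependent_of_infinite _
      (Finsupp.basisSingleOne (R := ℝ) (ι := s)).linearIndependent
  obtain ⟨v, hv, h0⟩ := LinearMap.exists_ne_zero_mem_ker hinf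
    (Φ ∘ₗ Finsupp.lmapDomain ℝ ℝ ((↑) : s → ℤ))
  refine ⟨v.mapDomain ((↑) : s → ℤ), ?_, fun i hi => ?_, h0⟩
  · intro h
    exact hv (Finsupp.mapDomain_injective Subtype.val_injective (by simpa using h))
  · classical
    obtain ⟨j, -, rfl⟩ := Finset.mem_image.mp (Finsupp.mapDomain_support hi)
    exact j.2

/-- A subalgebra of finite codimension in the Witt algebra contains a nonzero ideal of the ring of
Laurent polynomials. -/
theorem exists_laurentMul_mem (h : Submodule ℝ (ℤ →₀ ℝ))
    [FiniteDimensional ℝ ((ℤ →₀ ℝ) ⧸ h)]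
    (hlie : ∀ x ∈ h, ∀ y ∈ h, wittBracket x y ∈ h) :
    ∃ f : ℤ →₀ ℝ, f ≠ 0 ∧ ∀ g, laurentMul f g ∈ h := by
  let b := Module.finBasis ℝ ((ℤ →₀ ℝ) ⧸ h)
  choose e he using fun i => h.mkQ_surjective (b i)
  -- Membership in `h` together with bracketing everything into `h` amounts to finitely many linear
  -- conditions: it suffices to test on lifts of a basis of the quotient.
  let Φ : (ℤ →₀ ℝ) →ₗ[ℝ] ((ℤ →₀ ℝ) ⧸ h) × (Fin _ → (ℤ →₀ ℝ) ⧸ h) :=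
    h.mkQ.prod (LinearMap.pi fun i => h.mkQ ∘ₗ wittBracket.flip (e i))
  have hΦ : ∀ a, Φ a = 0 → ∀ x, wittBracket a x ∈ h := by
    intro a ha x
    have ha1 : a ∈ h := (Submodule.Quotient.mk_eq_zero h).mp (congrArg Prod.fst ha)
    have ha2 : ∀ i, wittBracket a (e i) ∈ h := fun i =>
      (Submodule.Quotient.mk_eq_zero h).mp (congrFun (congrArg Prod.snd ha) i)
    let y := ∑ i, b.repr (h.mkQ x) i • e i
    have hy : x - y ∈ h := by
      rw [← Submodule.Quotient.mk_eq_zero h]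
      change h.mkQ (x - y) = 0
      rw [map_sub, map_sum]
      simp only [map_smul, he, b.sum_repr, sub_self]
    have : wittBracket a x = wittBracket a (x - y) + wittBracket a y := by
      rw [← map_add, sub_add_cancel]
    rw [this]
    refine h.add_mem (hlie a ha1 _ hy) ?_
    rw [map_sum]
    exact h.sum_mem fun i _ => by
      rw [map_smul]
      exact h.smul_mem _ (ha2 i)
  -- Negative and nonnegative supports give distinct top degrees, which makes the bracket of `a` and
  -- `b` nonzero.
  obtain ⟨a, ha, hsa, h0a⟩ := exists_supported_mem_ker Φ (Set.Iio 0)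
  obtain ⟨b, hb, hsb, h0b⟩ := exists_supported_mem_ker Φ (Set.Ici 0)
  refine ⟨wittBracket a b, wittBracket_ne_zero ha hb hsa hsb, fun g => ?_⟩
  have := h.sub_mem (hΦ a h0a (laurentMul b g)) (hΦ b h0b (laurentMul a g))
  rw [wittBracket_laurentMul_sub] at this
  exact (h.smul_mem_iff (two_ne_zero)).mp this

/-! ### Third differences of the bracket and of the cocycle -/

/-- The third difference in `m` of `β (f T^m) (g T^{s-m})`. -/
def thirdDiff {W : Type*} [AddCommGroup W] [Module ℝ W]
    (β : (ℤ →₀ ℝ) →ₗ[ℝ] (ℤ →₀ ℝ) →ₗ[ℝ] W) (s : ℤ) (f g : ℤ →₀ ℝ) : W :=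
  ∑ k : Fin 4, ![-1, 3, -3, (1 : ℝ)] k •
    β (laurentMul f (Finsupp.single (k : ℤ) 1)) (laurentMul g (Finsupp.single (s - k) 1))

/-- On monomials the degree `i + j + s` is independent of `k` and the structure constant is affine
in `k`. -/
theorem thirdDiff_wittBracket (s : ℤ) (f g : ℤ →₀ ℝ) : thirdDiff wittBracket s f g = 0 := by
  unfold thirdDiff
  induction f using Finsupp.induction_linear with
  | zero => simp
  | add f f' hf hf' =>
    simp only [map_add, LinearMap.add_apply, smul_add, Finset.sum_add_distrib, hf, hf', add_zero]
  | single i x =>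
    induction g using Finsupp.induction_linear with
    | zero => simp
    | add f f' hf hf' =>
      simp only [map_add, LinearMap.add_apply, smul_add, Finset.sum_add_distrib, hf, hf', add_zero]
    | single j y =>
      rw [← mul_one x, ← mul_one y]
      simp only [← smul_eq_mul (b := (1 : ℝ)), ← Finsupp.smul_single, map_smul,
        LinearMap.smul_apply, wittBracket_single, laurentMul_single]
      have hk (k : Fin 4) : i + (k : ℤ) + (j + (s - k)) = i + j + s := by ring
      simp only [hk, smul_smul, ← Finset.sum_smul]
      convert zero_smul ℝ _
      simp [Fin.sum_univ_four]
      ring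

/-- On monomials the cocycle is a cubic in `k` with leading coefficient `1/12` if `i + j = -s`, and
zero otherwise; the third difference of the cubic is `3!/12`. -/
theorem thirdDiff_virasoroCocycle (s : ℤ) (f g : ℤ →₀ ℝ) :
    thirdDiff virasoroCocycle s f g = (1 / 2 : ℝ) * laurentMul f g (-s) := by
  unfold thirdDiff
  induction f using Finsupp.induction_linear with
  | zero => simp
  | add f f' hf hf' =>
    simp only [map_add, LinearMap.add_apply, smul_add, Finset.sum_add_distrib, hf, hf',
      Finsupp.add_apply, mul_add]
  | single i x =>
    induction g using Finsupp.induction_linear with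
    | zero => simp
    | add f f' hf hf' =>
      simp only [map_add, LinearMap.add_apply, smul_add, Finset.sum_add_distrib, hf, hf',
        Finsupp.add_apply, mul_add]
    | single j y =>
      rw [← mul_one x, ← mul_one y]
      simp only [← smul_eq_mul (b := (1 : ℝ)), ← Finsupp.smul_single, map_smul,
        LinearMap.smul_apply, virasoroCocycle_single, laurentMul_single, Finsupp.smul_apply,
        Finsupp.single_apply]
      have hk (k : Fin 4) : (i + (k : ℤ) = -(j + (s - k))) ↔ i + j = -s := by omega
      simp only [hk]
      by_cases hs : i + j = -s
      · simp [hs, Fin.sum_univ_four]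
        ring
      · simp [hs]

namespace Virasoro

/-- The projection of the Virasoro algebra to its `L`-part, as a linear map. -/
def fstₗ : Virasoro →ₗ[ℝ] (ℤ →₀ ℝ) := LinearMap.fst ℝ (ℤ →₀ ℝ) ℝ

/-- A subalgebra of finite codimension in the Virasoro algebra contains the central element. -/
theorem C_mem_of_finiteDimensional (h : Submodule ℝ Virasoro)
    [FiniteDimensional ℝ (Virasoro ⧸ h)] (hlie : ∀ x ∈ h, ∀ y ∈ h, ⁅x, y⁆ ∈ h) : C ∈ h := by
  have hfin : FiniteDimensional ℝ ((ℤ →₀ ℝ) ⧸ h.map fstₗ) := by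
    refine Module.Finite.of_surjective (h.mapQ (h.map fstₗ) fstₗ (Submodule.le_comap_map _ _)) ?_
    intro y
    obtain ⟨y, rfl⟩ := Submodule.Quotient.mk_surjective _ y
    exact ⟨Submodule.Quotient.mk ((y, (0 : ℝ)) : Virasoro), rfl⟩
  obtain ⟨f, hf, hmem⟩ := exists_laurentMul_mem (h.map fstₗ) (by
    rintro _ ⟨x, hx, rfl⟩ _ ⟨y, hy, rfl⟩
    exact ⟨⁅x, y⁆, hlie x hx y hy, rfl⟩)
  obtain ⟨t, ht⟩ := Finsupp.ne_iff.mp (laurentMul_self_ne_zero hf)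
  choose u hu hu' using fun m : ℤ => hmem (Finsupp.single m 1)
  -- The unknown central parts of the lifts `u k` do not affect brackets, so `v` is computed by the
  -- two third differences with `s = -t`.
  let v : Virasoro := ∑ k : Fin 4, ![-1, 3, -3, (1 : ℝ)] k • ⁅u k, u (-t - k)⁆
  have hv : v ∈ h := h.sum_mem fun k _ => h.smul_mem _ (hlie _ (hu _) _ (hu _))
  have hu1 (m : ℤ) : (u m).1 = laurentMul f (Finsupp.single m 1) := hu' m
  have hv1 : v.1 = 0 := by
    rw [← thirdDiff_wittBracket (-t) f f]
    change fstₗ v = _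
    simp only [v, map_sum, map_smul, thirdDiff, ← hu1]
    rfl
  have hv2 : v.2 = (1 / 2 : ℝ) * laurentMul f f t := by
    rw [← neg_neg t, ← thirdDiff_virasoroCocycle (- t) f f]
    change LinearMap.snd ℝ (ℤ →₀ ℝ) ℝ v = _
    simp only [thirdDiff, ← hu1]
    exact map_sum (LinearMap.snd ℝ (ℤ →₀ ℝ) ℝ) _ _
  have hc : (1 / 2 : ℝ) * laurentMul f f t ≠ 0 := mul_ne_zero (by norm_num) ht
  rw [← h.smul_mem_iff hc]
  convert hv using 1
  refine Prod.ext ?_ ?_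
  · exact (smul_zero _).trans hv1.symm
  · exact (mul_one _).trans hv2.symm

/-- The central element acts by zero in every realization by vector fields in finitely many
variables. -/
theorem realization_C_eq_zero {n : ℕ} {U : TopologicalSpace.Opens (EuclideanSpace ℝ (Fin n))}
    (ρ : Realization Virasoro U) : ρ C = 0 := by
  refine SmoothVectorField.ext_on fun p hp => ?_
  let ev : Virasoro →ₗ[ℝ] EuclideanSpace ℝ (Fin n) :=
    { toFun := fun x => (ρ x).coeff p
      map_add' := fun x y => by rw [map_add]; rfl
      map_smul' := fun c x => by rw [map_smul]; rfl }
  have : FiniteDimensional ℝ (Virasoro ⧸ LinearMap.ker ev) :=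
    FiniteDimensional.of_injective ((LinearMap.ker ev).liftQ ev le_rfl)
      (LinearMap.ker_eq_bot.mp (Submodule.ker_liftQ_eq_bot _ _ _ le_rfl))
  refine C_mem_of_finiteDimensional (LinearMap.ker ev) fun x hx y hy => ?_
  have hx : (ρ x).coeff p = 0 := hx
  have hy : (ρ y).coeff p = 0 := hy
  change (ρ ⁅x, y⁆).coeff p = 0
  -- Each term of the bracket at `p` is a derivative applied to the value of a field at `p`, hence
  -- zero.
  rw [LieHom.map_lie, SmoothVectorField.lie_coeff _ _ hp, VectorField.lieBracket, hx, hy]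
  simp

end Virasoro

end

noncomputable section

/-! ### Central extensions of the Witt algebra -/

namespace IsCentralExtension

variable {E : Type*} [LieRing E] [LieAlgebra ℝ E] {π : E →ₗ⁅ℝ⁆ Witt}

theorem lie_eq_zero (hπ : IsCentralExtension π) {z : E} (hz : π z = 0) (x : E) : ⁅z, x⁆ = 0 := by
  rw [← lie_skew, hπ.central z hz, neg_zero]

/-- Lifts `e m` of the `L m` that are eigenvectors of `ad (e 0)`. -/
theorem exists_eigenlift (hπ : IsCentralExtension π) :
    ∃ e : ℤ → E, (∀ m, π (e m) = Witt.L m) ∧ (∀ m, ⁅e 0, e m⁆ = (-(m : ℝ)) • e m) ∧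
      ⁅e 1, e (-1)⁆ = (2 : ℝ) • e 0 := by
  choose l hl using fun m => hπ.surjective (Witt.L m)
  -- Brackets of lifts do not depend on the lifts, so defining `e` through brackets of the `l m`
  -- fixes the normalization.
  let e : ℤ → E := fun m => if m = 0 then (2⁻¹ : ℝ) • ⁅l 1, l (-1)⁆ else
    (-(m : ℝ)⁻¹) • ⁅l 0, l m⁆
  have he0 : e 0 = (2⁻¹ : ℝ) • ⁅l 1, l (-1)⁆ := if_pos rfl
  have hem (m : ℤ) (hm : m ≠ 0) : e m = (-(m : ℝ)⁻¹) • ⁅l 0, l m⁆ := if_neg hm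
  have hπe (m : ℤ) : π (e m) = Witt.L m := by
    by_cases hm : m = 0
    · subst hm
      rw [he0, map_smul, LieHom.map_lie, hl, hl, Witt.lie_L_L, smul_smul, add_neg_cancel]
      norm_num
    · have : (m : ℝ) ≠ 0 := by exact_mod_cast hm
      rw [hem m hm, map_smul, LieHom.map_lie, hl, hl, Witt.lie_L_L, smul_smul, zero_add]
      convert one_smul ℝ _
      push_cast
      field_simp
      ring
  have hlie (m n : ℤ) : ⁅e m, e n⁆ = ⁅l m, l n⁆ := by
    have h1 : ⁅e m - l m, e n⁆ = 0 := hπ.lie_eq_zero (by rw [map_sub, hπe, hl, sub_self]) _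
    have h2 : ⁅l m, e n - l n⁆ = 0 := hπ.central _ (by rw [map_sub, hπe, hl, sub_self]) _
    rw [sub_lie, sub_eq_zero] at h1
    rw [lie_sub, sub_eq_zero] at h2
    rw [h1, h2]
  refine ⟨e, hπe, fun m => ?_, ?_⟩
  · by_cases hm : m = 0
    · subst hm
      simp
    · have : (m : ℝ) ≠ 0 := by exact_mod_cast hm
      rw [hlie, hem m hm, smul_smul]
      field_simp
      simp
  · rw [hlie, he0, smul_smul]
    norm_num

/-- Every central extension of the Witt algebra is, up to a choice of lifts, given by a multiple of
the Virasoro cocycle. -/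
theorem exists_virasoro_lift (hπ : IsCentralExtension π) :
    ∃ (e : ℤ → E) (z : E), (∀ m, π (e m) = Witt.L m) ∧ π z = 0 ∧ ∀ m n,
      ⁅e m, e n⁆ = ((m : ℝ) - n) • e (m + n) +
        (if m = -n then (1 / 12 : ℝ) * (m : ℝ) * ((m : ℝ) ^ 2 - 1) else 0) • z := by
  obtain ⟨e, hπe, he0, he1⟩ := hπ.exists_eigenlift
  let c : ℤ → ℤ → E := fun m n => ⁅e m, e n⁆ - ((m : ℝ) - n) • e (m + n)
  have hc (m n : ℤ) : ⁅e m, e n⁆ = ((m : ℝ) - n) • e (m + n) + c m n := by simp [c]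
  have hπc (m n : ℤ) : π (c m n) = 0 := by
    simp only [c, map_sub, map_smul, LieHom.map_lie, hπe, Witt.lie_L_L, sub_self]
  have hskew (m n : ℤ) : c m n = -c n m := by
    simp only [c]
    rw [← lie_skew, add_comm n m, ← neg_sub (m : ℝ) n, neg_smul]
    abel
  have hjac (l m n : ℤ) : ((m : ℝ) - n) • c l (m + n) =
      ((l : ℝ) - m) • c (l + m) n + ((l : ℝ) - n) • c m (l + n) := by
    have h := leibniz_lie (e l) (e m) (e n)
    rw [hc m n, hc l m, hc l n, lie_add, add_lie, lie_add, lie_smul, smul_lie, lie_smul,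
      hπ.central _ (hπc m n), hπ.central _ (hπc l n), hπ.lie_eq_zero (hπc l m), add_zero, add_zero,
      add_zero, hc l, hc (l + m), hc m, show l + m + n = l + (m + n) by ring,
      show m + (l + n) = l + (m + n) by ring] at h
    have h' := sub_eq_zero.mpr h
    rw [← sub_eq_zero, ← h']
    push_cast
    module
  have hzero (m n : ℤ) (hmn : m ≠ -n) : c m n = 0 := by
    have h0 (k : ℤ) : c 0 k = 0 := by
      simp only [c, he0, zero_add]
      push_cast
      module
    have h := hjac 0 m n
    rw [h0, zero_add, zero_add, smul_zero, ← add_smul] at h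
    refine (smul_eq_zero.mp h.symm).resolve_left ?_
    have : (m : ℝ) + n ≠ 0 := by
      exact_mod_cast (by omega : m + n ≠ 0)
    push_cast
    intro h
    exact this (by linarith)
  have hrec (m : ℤ) : ((m : ℝ) - 1) • c (m + 1) (-(m + 1)) = ((m : ℝ) + 2) • c m (-m) := by
    have h := hjac 1 m (-(m + 1))
    have h1 : c 1 (-1) = 0 := by
      simp only [c, he1, add_neg_cancel]
      push_cast
      module
    rw [show m + -(m + 1) = -1 by ring, show 1 + -(m + 1) = -m by ring, add_comm 1 m, h1,
      smul_zero] at h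
    rw [← sub_eq_zero]
    have h' := h.symm
    push_cast at h'
    rw [← neg_eq_zero, ← h']
    module
  -- The recursion degenerates at `m = 1`, so `c 2 (-2)` is a free parameter and determines all
  -- later values.
  have hnat (k : ℕ) : c (k + 2) (-(k + 2)) =
      (((k : ℝ) + 2) * (((k : ℝ) + 2) ^ 2 - 1) / 6) • c 2 (-2) := by
    induction k with
    | zero =>
      norm_num
    | succ k ih =>
      have h := hrec (k + 2)
      rw [ih, smul_smul] at h
      have hk : ((k : ℝ) + 1) ≠ 0 := by positivity
      have h2 := congrArg (((k : ℝ) + 1)⁻¹ • ·) h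
      simp only [smul_smul] at h2
      rw [show (((k + 1 : ℕ) : ℤ) + 2) = k + 2 + 1 by push_cast; ring]
      convert h2 using 1
      · convert (one_smul ℝ _).symm
        push_cast
        field_simp
        ring
      · congr 1
        push_cast
        field_simp
        ring
  have hpos (m : ℤ) (hm : 0 ≤ m) :
      c m (-m) = ((m : ℝ) * ((m : ℝ) ^ 2 - 1) / 6) • c 2 (-2) := by
    rcases (by omega : m = 0 ∨ m = 1 ∨ 2 ≤ m) with rfl | rfl | h
    · simp [c]
    · simp [c, he1]
      module
    · obtain ⟨k, hk⟩ := Int.eq_ofNat_of_zero_le (by omega : 0 ≤ m - 2)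
      obtain rfl : m = k + 2 := by omega
      rw [hnat]
      push_cast
      rfl
  -- The factor `2` converts the `1/6` above into the conventional `1/12`.
  refine ⟨e, (2 : ℝ) • c 2 (-2), hπe, by rw [map_smul, hπc, smul_zero], fun m n => ?_⟩
  rw [hc]
  congr 1
  split_ifs with h
  · obtain rfl : n = -m := by omega
    rw [smul_smul]
    rcases le_total 0 m with hm | hm
    · rw [hpos m hm]
      congr 1
      ring
    · have := hpos (-m) (by omega)
      rw [neg_neg] at this
      rw [hskew, this, ← neg_smul]
      congr 1
      push_cast
      ring
  · rw [zero_smul, hzero m n h]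

end IsCentralExtension

/-- The Lie algebra homomorphism from the Virasoro algebra determined by images of the `L m` and of
the central element. -/
def Virasoro.lift {E : Type*} [LieRing E] [LieAlgebra ℝ E] (e : ℤ → E) (z : E)
    (hz : ∀ x : E, ⁅x, z⁆ = 0)
    (he : ∀ m n, ⁅e m, e n⁆ = ((m : ℝ) - n) • e (m + n) +
        (if m = -n then (1 / 12 : ℝ) * (m : ℝ) * ((m : ℝ) ^ 2 - 1) else 0) • z) :
    Virasoro →ₗ⁅ℝ⁆ E where
  __ := ((Finsupp.linearCombination ℝ e).coprod (LinearMap.toSpanSingleton ℝ E z) :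
    (ℤ →₀ ℝ) × ℝ →ₗ[ℝ] E)
  map_lie' := by
    rintro ⟨x, a⟩ ⟨y, b⟩
    have key : ⁅Finsupp.linearCombination ℝ e x, Finsupp.linearCombination ℝ e y⁆ =
        Finsupp.linearCombination ℝ e (wittBracket x y) + virasoroCocycle x y • z := by
      induction x using Finsupp.induction_linear with
      | zero => simp
      | add f g hf hg => simp only [map_add, LinearMap.add_apply, add_lie, hf, hg, add_smul]; abel
      | single m a =>
        induction y using Finsupp.induction_linear with
        | zero => simp
        | add f g hf hg =>
          simp only [map_add, lie_add, hf, hg, add_smul]; abel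
        | single n b =>
          rw [← mul_one a, ← mul_one b]
          simp only [← smul_eq_mul (b := (1 : ℝ)), ← Finsupp.smul_single, map_smul,
            LinearMap.smul_apply, wittBracket_single, virasoroCocycle_single,
            Finsupp.linearCombination_single, one_smul, smul_lie, lie_smul, he, smul_add,
            smul_assoc]
    have hz' (x : E) : ⁅z, x⁆ = 0 := by rw [← lie_skew, hz, neg_zero]
    change Finsupp.linearCombination ℝ e (wittBracket x y) + virasoroCocycle x y • z =
      ⁅Finsupp.linearCombination ℝ e x + a • z, Finsupp.linearCombination ℝ e y + b • z⁆
    rw [lie_add, add_lie, lie_smul, hz, smul_lie, hz', smul_zero, smul_zero, add_zero, add_zero,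
      key]

/-- A central extension of the Witt algebra with a realization by vector fields that is injective on
the kernel splits. -/
theorem IsCentralExtension.isSplitExtension_of_realization {E : Type*} [LieRing E]
    [LieAlgebra ℝ E] {π : E →ₗ⁅ℝ⁆ Witt} (hπ : IsCentralExtension π) {n : ℕ}
    {U : TopologicalSpace.Opens (EuclideanSpace ℝ (Fin n))} (ρ : Realization E U)
    (hρ : ∀ z : E, π z = 0 → ρ z = 0 → z = 0) : IsSplitExtension π := by
  obtain ⟨e, z, hπe, hπz, he⟩ := hπ.exists_virasoro_lift
  let φ := Virasoro.lift e z (hπ.central z hπz) he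
  have hφ (x : ℤ →₀ ℝ) (a : ℝ) : φ ((x, a) : (ℤ →₀ ℝ) × ℝ) =
    Finsupp.linearCombination ℝ e x + a • z := rfl
  -- Pulling `ρ` back along `φ` realizes the Virasoro algebra with `C` acting as `ρ z`, which
  -- therefore vanishes.
  obtain rfl : z = 0 := by
    refine hρ z hπz ?_
    have h := Virasoro.realization_C_eq_zero (ρ.comp φ)
    have hC : φ Virasoro.C = z := (hφ 0 1).trans (by simp)
    rwa [LieHom.comp_apply, hC] at h
  refine ⟨{ (Finsupp.linearCombination ℝ e : (ℤ →₀ ℝ) →ₗ[ℝ] E) with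
    map_lie' := fun {x y} => ?_ }, fun x => ?_⟩
  · have hφ0 (x : ℤ →₀ ℝ) (a : ℝ) : φ ((x, a) : (ℤ →₀ ℝ) × ℝ) =
        Finsupp.linearCombination ℝ e x := by rw [hφ, smul_zero, add_zero]
    have h := φ.map_lie ((x, (0 : ℝ)) : (ℤ →₀ ℝ) × ℝ) ((y, (0 : ℝ)) : (ℤ →₀ ℝ) × ℝ)
    exact (hφ0 (wittBracket x y) (virasoroCocycle x y)).symm.trans
      (h.trans (congrArg₂ _ (hφ0 x 0) (hφ0 y 0)))
  · have h : (π : E →ₗ[ℝ] Witt) ∘ₗ (Finsupp.linearCombination ℝ e) =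
        (LinearMap.id : (ℤ →₀ ℝ) →ₗ[ℝ] (ℤ →₀ ℝ)) := by
      ext m : 2
      simp [hπe]
      rfl
    exact LinearMap.congr_fun h x

end

theorem theorem4 (n : ℕ) (hn : n = 1 ∨ n = 2 ∨ n = 3)
    (U : TopologicalSpace.Opens (EuclideanSpace ℝ (Fin n))) :
    (¬ ∃ ρ : Realization Virasoro U, ρ Virasoro.C ≠ 0) ∧
    (∀ (E : Type*) [LieRing E] [LieAlgebra ℝ E] (π : E →ₗ⁅ℝ⁆ Witt) (ρ : Realization E U),
      IsCentralExtension π → (∀ z : E, π z = 0 → ρ z = 0 → z = 0) →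
        IsSplitExtension π) :=
  ⟨fun ⟨ρ, hρ⟩ => hρ (Virasoro.realization_C_eq_zero ρ),
    fun _ _ _ _ ρ hπ hρ => hπ.isSplitExtension_of_realization ρ hρ⟩
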